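/- Let $a,b$ be integers with $2\le a\le b-2$, let $\rho$ be a root of $f(x)=x^3-(a+b)x^2+abx-1$, and let $K=\mathbb{Q}(\rho)$, which is a totally real cubic field. Call an element of $K$ totally positive if its image under every embedding $K\to\mathbb{R}$ is positive, and call a totally positive element $\alpha\in\mathbb{Z}[\rho]$ indecomposable in $\mathbb{Z}[\rho]$ if it is not a sum of two totally positive elements of $\mathbb{Z}[\rho]$. Let $N$ denote the norm from $K$ to $\mathbb{Q}$, and for integers $v,W$ put \[ \alpha(v,W)=-v+\bigl(b(av+W)+1\bigr)\rho-(av+W)\rho^2 . \] Write $b-a=2L+l_0$ with $L\in\mathbb{Z}$ and $l_0\in\{0,1\}$. If $\alpha$ is indecomposable in $\mathbb{Z}[\rho]$, then \[ N(\alpha)\le\begin{cases} 16 & \text{if } a=2 \text{ and } b=4,\\ \max\{N(\alpha(v,a-1)) : v\in\mathbb{Z},\ L-1\le v\le 2L-1\} & \text{if } (a,b)\ne(2,4) \text{ and } l_0=0,\\ \max\{N(\alpha(v,a-1)) : v\in\mathbb{Z},\ L\le v\le 2L\} & \text{if } (a,b)\neq(2,4) \text{ and } l_0=1. \end{cases}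 \] -/

import Mathlib

/-- The polynomial `x³ - (a+b)x² + abx - 1` of the family of orders with exceptional units. -/
noncomputable def thomasPoly (a b : ℤ) : Polynomial ℤ :=
  Polynomial.X ^ 3 - Polynomial.C (a + b) * Polynomial.X ^ 2
    + Polynomial.C (a * b) * Polynomial.X - 1

/-- `x ≻ 0`: the image of `x` under every embedding of `K` into `ℝ` is positive
(for `K` a totally real field). -/
def IsTotallyPositive {K : Type*} [Field K] (x : K) : Prop :=
  ∀ σ : K →+* ℝ, 0 < σ x

/-- `α` is indecomposable in the order `O`: it is a totally positive element of `O` and is not the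
sum of two totally positive elements of `O`. -/
def IsIndecomposableIn {K : Type*} [Field K] (O : Subalgebra ℤ K) (α : K) : Prop :=
  α ∈ O ∧ IsTotallyPositive α ∧
    ¬ ∃ β ∈ O, ∃ γ ∈ O, IsTotallyPositive β ∧ IsTotallyPositive γ ∧ α = β + γ

/-- The element `α(v, W) = -v + (b(av + W) + 1)ρ - (av + W)ρ²`. -/
def thomasElement {K : Type*} [Field K] (ρ : K) (a b v W : ℤ) : K :=
  -(v : K) + ((b : K) * ((a : K) * v + W) + 1) * ρ - ((a : K) * v + W) * ρ ^ 2

/-- `max {N(α(v, a - 1)) : lo ≤ v ≤ hi}`, with the value `⊥` (below every rational number) when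
there is no integer in the interval. -/
noncomputable def maxNormInWindow {K : Type*} [Field K] [NumberField K] (ρ : K) (a b lo hi : ℤ) :
    WithBot ℚ :=
  ((Finset.Icc lo hi).image fun v => Algebra.norm ℚ (thomasElement ρ a b v (a - 1))).max

/-!
Write `d = b - a`. The roots of `x (x - a) (x - b) = 1` are real: one lies in `(0, 1/a)`, one in
`(1, a)` and one beyond `b`. Hence `ρ`, `p = (ρ - a) (ρ - b) = ρ⁻¹`, `q = (ρ - a)²` and
`δ² = (ρ (ρ - b))² = q⁻¹` are totally positive units of `ℤ[ρ]`, of norm `1`.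

*Reduction to two cones.* Up to multiplication by these units, every indecomposable element lies in
the closed cone spanned by `1, ρ, δ²` (the primary cone) or in the one spanned by `1, p, q` (the
secondary cone). This is shown without a fundamental domain for the whole unit group. Let `ℓ₁` and
`ℓ₂` be the linear forms with value `a` on the generators of the primary and of the secondary cone.
They are integral on `ℤ[ρ]` and nonnegative on totally positive elements
(`functionals_nonneg`), so among all indecomposable `β` with the norm of `α` and both forms there is
a smallest value. If it is `ℓ₁ β`, then comparison with `ℓ₂ (p β)`, `ℓ₂ (q β)` and `ℓ₂ (p q β)`, the
forms of the three translated secondary cones that share a face with the primary one, says that the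
coordinates of `β` with respect to `1, ρ, δ²` are nonnegative: the difference of two such forms
vanishes on the common face, hence is a positive multiple of the remaining coordinate. The case of
`ℓ₂ β` is the same with the cones exchanged.

*Lattice points.* If a coordinate of `β` is at least `1`, subtracting the corresponding generator
leaves an element of the cone, so indecomposability forces `β` to be that generator, and its norm
is `1`. The remaining lattice points of the half-open parallelepipeds are the elements `α(v, W)`
with `0 ≤ v < d` and `0 ≤ W < a`, and the elements `(ρ - a) (ρ - (b - k))` with `0 < k < d`, of norm
`1 + k (b - k) (d - k)` (`hasSmallNorm_of_isIndecomposableIn`).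

*Comparison of norms.* The norm of `α(v, W)` is the polynomial `thomasNorm a b v W`. It is at most
`thomasNorm a b v (a - 1)`, except possibly when `v = d - 1` and `b < 2 (a - 1)`, where
`thomasNorm a b (d - 2) (a - 1)` is an upper bound. The norm of `(ρ - a) (ρ - (b - k))` is at most
that of `α(d - k, a - 1)`. Finally the reflection `v ↦ d - 2 - v` does not decrease
`thomasNorm a b v (a - 1)` for `v` in the lower half of the range, and moves `v` into the window.
-/

/-! ### Comparison of the norm polynomials -/

/-- The norm of `α(v, W)`, see `norm_thomasElement`. The leading term is the product of the values
at `0`, `a` and `b` of the polynomial `(a + v) x + W - x²`, up to sign. -/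
def thomasNorm (a b v W : ℤ) : ℤ :=
  W * (a * v + W) * (b * (b - a - v) - W) + (a + v) * (b - a - v) * v
    + W * (2 * (b - a - v) + a - v) + 1

theorem thomasNorm_mono {a b v W : ℤ} (ha : 2 ≤ a) (hv : 0 ≤ v)
    (hvd : v < b - a) (hW : 0 ≤ W) (hWa : W < a) (hu : 2 * (a - 1) ≤ b * (b - a - v)) :
    thomasNorm a b v W ≤ thomasNorm a b v (a - 1) := by
  rcases eq_or_lt_of_le (show W ≤ a - 1 by omega) with h | h
  · rw [h]
  have key : thomasNorm a b v (a - 1) - thomasNorm a b v W = (a - 1 - W) *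
      (a * v * (b * (b - a - v) - (a - 1 + W)) + (b * (b - a - v) * (a - 1 + W)
        - ((a - 1) ^ 2 + (a - 1) * W + W ^ 2)) + (2 * (b - a - v) + a - v)) := by
    unfold thomasNorm; ring
  have h1 : 1 ≤ b * (b - a - v) - (a - 1 + W) := by linarith
  have h2 : a * v ≤ a * v * (b * (b - a - v) - (a - 1 + W)) :=
    le_mul_of_one_le_right (by positivity) h1
  have h3 : 2 * (a - 1) * (a - 1 + W) ≤ b * (b - a - v) * (a - 1 + W) :=
    mul_le_mul_of_nonneg_right hu (by linarith)
  have h4 : 0 ≤ (a - 1 - W) * W := mul_nonneg (by linarith) hW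
  have h5 : v ≤ a * v := le_mul_of_one_le_left hv (by linarith)
  have : 0 ≤ thomasNorm a b v (a - 1) - thomasNorm a b v W := by
    rw [key]
    refine mul_nonneg (by linarith) ?_
    nlinarith
  linarith

/-- For `v = b - a - 1` and `b` small compared with `2 * a` the norm need not increase with
`W`; the element `α(b - a - 2, a - 1)` serves as the upper bound instead. -/
theorem thomasNorm_le_of_short {a b W : ℤ} (hab : a ≤ b - 2) (hW : 0 ≤ W) (hWa : W < a)
    (hb : b < 2 * (a - 1)) :
    thomasNorm a b (b - a - 1) W ≤ thomasNorm a b (b - a - 2) (a - 1) := by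
  obtain ⟨d, rfl⟩ : ∃ d, b = a + d := ⟨b - a, by ring⟩
  have hd : 2 ≤ d := by linarith
  have hda : d ≤ a - 3 := by linarith
  have h1 : 4 * (W * (a + d - W)) ≤ (a + d) ^ 2 := by nlinarith [sq_nonneg (a + d - 2 * W)]
  have hX : 0 ≤ W * (a + d - W) := mul_nonneg hW (by linarith)
  have h2 : W * (a + d - W) * (a * (d - 1) + W) ≤ W * (a + d - W) * (a * d - 1) :=
    mul_le_mul_of_nonneg_left (by nlinarith) hX
  have hP : 0 ≤ a * d - 1 := by nlinarith
  have h3 : 4 * (W * (a + d - W)) * (a * d - 1) ≤ (a + d) ^ 2 * (a * d - 1) :=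
    mul_le_mul_of_nonneg_right h1 hP
  -- In the leading terms, `W * (b - W)` is bounded by `b ^ 2 / 4`; the product of the next three
  -- inequalities then gives what is needed, after cancelling common factors.
  have h4 : (a + d) ^ 2 ≤ (2 * a - 3) * (a + 2 * d + 1) := by nlinarith
  have h5 : (a * d - 1) * (a - 1) ≤ (2 * a - 1) * (a * d - a - 1) := by
    nlinarith [mul_nonneg (sq_nonneg a) (show 0 ≤ d - 2 by linarith)]
  have h6 : (2 * a - 3) * (2 * a - 1) ≤ 4 * (a - 1) ^ 2 := by nlinarith
  have h7 : (a + d) ^ 2 * (a * d - 1) ≤ 4 * ((a - 1) * (a * d - a - 1) * (a + 2 * d + 1)) := by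
    have e1 : (a + d) ^ 2 * (a * d - 1) ≤ (2 * a - 3) * (a + 2 * d + 1) * (a * d - 1) :=
      mul_le_mul_of_nonneg_right h4 hP
    have e2 : (a * d - 1) * (a - 1) * ((2 * a - 3) * (a + 2 * d + 1)) ≤
        (2 * a - 1) * (a * d - a - 1) * ((2 * a - 3) * (a + 2 * d + 1)) :=
      mul_le_mul_of_nonneg_right h5 (mul_nonneg (by linarith) (by linarith))
    have e3 : (2 * a - 3) * (2 * a - 1) * ((a * d - a - 1) * (a + 2 * d + 1)) ≤
        4 * (a - 1) ^ 2 * ((a * d - a - 1) * (a + 2 * d + 1)) :=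
      mul_le_mul_of_nonneg_right h6 (mul_nonneg (by nlinarith) (by linarith))
    have e4 : (a - 1) * ((a + d) ^ 2 * (a * d - 1)) ≤
        (a - 1) * (4 * ((a - 1) * (a * d - a - 1) * (a + 2 * d + 1))) := by
      have := mul_le_mul_of_nonneg_right e1 (show 0 ≤ a - 1 by linarith)
      linarith
    exact le_of_mul_le_mul_left e4 (by linarith)
  have h8 : W * (a + 3 - d) ≤ (a - 1) * (a + 3 - d) :=
    mul_le_mul_of_nonneg_right (by linarith) (by linarith)
  have h9 : (a + d - 1) * (d - 1) ≤ 2 * (a + d - 2) * (d - 2) + 3 * (a - 1) := by nlinarith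
  unfold thomasNorm
  nlinarith

/-- As a function of `v`, the leading term of `thomasNorm a b v (a - 1)` is a concave parabola whose
vertex is to the right of `(b - a - 2) / 2`. -/
theorem thomasNorm_le_reflect {a b v : ℤ} (ha : 2 ≤ a) (hab : a ≤ b - 2) (hv : 0 ≤ v)
    (hvd : 2 * v ≤ b - a - 2) :
    thomasNorm a b v (a - 1) ≤ thomasNorm a b (b - a - 2 - v) (a - 1) := by
  obtain ⟨v', hv'⟩ : ∃ v', v' = b - a - 2 - v := ⟨_, rfl⟩
  rw [← hv']
  have hb : b = a + 2 + v + v' := by linarith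
  have key : thomasNorm a b v' (a - 1) - thomasNorm a b v (a - 1) = (v' - v) *
      ((a - 1) * (a * (b - a + 1) + b - 3) + 2 * a + v * v' + 2 * (v' + v)) := by
    rw [hb]; unfold thomasNorm; ring
  have : 0 ≤ thomasNorm a b v' (a - 1) - thomasNorm a b v (a - 1) := by
    rw [key]
    refine mul_nonneg (by linarith) ?_
    have : 0 ≤ (a - 1) * (a * (b - a + 1) + b - 3) := mul_nonneg (by linarith) (by nlinarith)
    have : 0 ≤ v * v' := mul_nonneg hv (by linarith)
    linarith
  linarith

/-- The left-hand side is the norm of `(ρ - a) (ρ - (b - k))`. -/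
theorem edgeNorm_le_thomasNorm {a b k : ℤ} (ha : 2 ≤ a) (hk : 0 < k) (hkd : k < b - a) :
    1 + k * (b - k) * (b - a - k) ≤ thomasNorm a b (b - a - k) (a - 1) := by
  have key : thomasNorm a b (b - a - k) (a - 1) - (1 + k * (b - k) * (b - a - k)) =
      (a - 1) * ((a * (b - a - k) + (a - 1)) * (b * k - (a - 1)) + (3 * k + a - (b - a))) := by
    unfold thomasNorm; ring
  have h1 : b - a + 1 ≤ b * k - (a - 1) := by nlinarith
  have h2 : 1 ≤ a * (b - a - k) + (a - 1) := by nlinarith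
  have h3 : 1 * (b - a + 1) ≤ (a * (b - a - k) + (a - 1)) * (b * k - (a - 1)) :=
    mul_le_mul h2 h1 (by linarith) (by linarith)
  have : 0 ≤ thomasNorm a b (b - a - k) (a - 1) - (1 + k * (b - k) * (b - a - k)) := by
    rw [key]
    exact mul_nonneg (by linarith) (by linarith)
  linarith

theorem exists_thomasNorm_ge {a b v W : ℤ} (ha : 2 ≤ a) (hab : a ≤ b - 2) (hv : 0 ≤ v)
    (hvd : v < b - a) (hW : 0 ≤ W) (hWa : W < a) :
    ∃ v', 0 ≤ v' ∧ v' < b - a ∧ thomasNorm a b v W ≤ thomasNorm a b v' (a - 1) := by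
  by_cases hu : 2 * (a - 1) ≤ b * (b - a - v)
  · exact ⟨v, hv, hvd, thomasNorm_mono ha hv hvd hW hWa hu⟩
  · -- `b - a - v` cannot be `2` or more, as `b` exceeds `a - 1`
    have hv1 : v = b - a - 1 := by
      by_contra hne
      have : 2 ≤ b - a - v := by omega
      nlinarith
    subst hv1
    refine ⟨b - a - 2, by linarith, by linarith, thomasNorm_le_of_short hab hW hWa ?_⟩
    nlinarith

/-- Both windows of the theorem satisfy the hypotheses on `lo` and `hi`. -/
theorem exists_mem_window_thomasNorm_ge {a b v lo hi : ℤ} (ha : 2 ≤ a) (hab : a ≤ b - 2)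
    (hv : 0 ≤ v) (hvd : v < b - a) (hlo : b - a - 2 ≤ 2 * lo) (hlo' : 2 * lo ≤ b - a - 1)
    (hhi : hi = b - a - 1) :
    ∃ v' ∈ Finset.Icc lo hi, thomasNorm a b v (a - 1) ≤ thomasNorm a b v' (a - 1) := by
  by_cases h : lo ≤ v
  · exact ⟨v, Finset.mem_Icc.2 ⟨h, by omega⟩, le_rfl⟩
  · exact ⟨b - a - 2 - v, Finset.mem_Icc.2 ⟨by omega, by omega⟩,
      thomasNorm_le_reflect ha hab hv (by omega)⟩

theorem one_le_thomasNorm {a b : ℤ} (ha : 2 ≤ a) (hab : a ≤ b - 2) :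
    1 ≤ thomasNorm a b 0 (a - 1) := by
  have h1 : 0 ≤ b * (b - a) - (a - 1) := by nlinarith
  have : 0 ≤ (a - 1) * ((a - 1) * (b * (b - a) - (a - 1)) + (2 * (b - a) + a)) :=
    mul_nonneg (by linarith) (add_nonneg (mul_nonneg (by linarith) h1) (by linarith))
  unfold thomasNorm
  linarith

/-! ### The real roots and positivity of the two linear forms -/

theorem exists_real_roots {a b : ℤ} (ha : 2 ≤ a) (hab : a ≤ b - 2) :
    ∃ r s t : ℝ, (0 < r ∧ a * r < 1) ∧ (1 < s ∧ s < a) ∧ b < t ∧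
      ∀ x ∈ ({r, s, t} : Set ℝ), x * (x - a) * (x - b) = 1 := by
  have ha' : (2 : ℝ) ≤ a := by exact_mod_cast ha
  have hab' : (a : ℝ) ≤ b - 2 := by exact_mod_cast hab
  have hcont : ∀ S : Set ℝ, ContinuousOn (fun x : ℝ => x * (x - a) * (x - b)) S :=
    fun S => by fun_prop
  have h1 : (1 : ℝ) / a < 1 := by rw [div_lt_one (by linarith)]; linarith
  have h0 : (0 : ℝ) < 1 / a := by positivity
  obtain ⟨r, ⟨hr0, hr1⟩, hr⟩ := intermediate_value_Ioo h0.le (hcont (Set.Icc 0 (1 / a)))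
    (show (1 : ℝ) ∈ _ from by
      refine ⟨by simp, ?_⟩
      have e : (1 : ℝ) / a * (1 / a - a) * (1 / a - b) = (a ^ 2 - 1) * (a * b - 1) / a ^ 3 := by
        field_simp
        ring
      rw [e, lt_div_iff₀ (by positivity)]
      nlinarith [mul_nonneg (show (0 : ℝ) ≤ a ^ 2 - 1 by nlinarith)
        (show (0 : ℝ) ≤ a * b - 1 - (a * (a + 2) - 1) by nlinarith), sq_nonneg (a : ℝ),
        mul_nonneg (sq_nonneg (a : ℝ)) (show (0 : ℝ) ≤ a - 2 by linarith)])
  obtain ⟨s, ⟨hs0, hs1⟩, hs⟩ := intermediate_value_Ioo' (show (1 : ℝ) ≤ a by linarith)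
    (hcont (Set.Icc 1 a)) (show (1 : ℝ) ∈ _ from ⟨by simp, by nlinarith⟩)
  obtain ⟨t, ⟨ht0, ht1⟩, ht⟩ := intermediate_value_Ioo (show (b : ℝ) ≤ b + 1 by linarith)
    (hcont (Set.Icc (b : ℝ) (b + 1))) (show (1 : ℝ) ∈ _ from ⟨by simp, by nlinarith⟩)
  refine ⟨r, s, t, ⟨hr0, ?_⟩, ⟨hs0, hs1⟩, ht0, ?_⟩
  · rw [lt_div_iff₀ (by linarith)] at hr1
    linarith
  · rintro x (rfl | rfl | rfl)
    exacts [hr, hs, ht]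

/-- A linear form on polynomials `x + y X + z X²`, with values `A, B, C` on `1, X, X²`, is
nonnegative on polynomials that are positive at `r < s < t` as soon as it is nonnegative on the
three Lagrange interpolation polynomials of these nodes. -/
theorem functional_nonneg {r s t : ℝ} (hrs : r < s) (hst : s < t) {A B C x y z : ℝ}
    (hr : 0 ≤ s * t * A - (s + t) * B + C) (hs : r * t * A - (r + t) * B + C ≤ 0)
    (ht : 0 ≤ r * s * A - (r + s) * B + C)
    (h : ∀ u ∈ ({r, s, t} : Set ℝ), 0 < x + y * u + z * u ^ 2) :
    0 ≤ A * x + B * y + C * z := by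
  have pr := h r (by simp)
  have ps := h s (by simp)
  have pt := h t (by simp)
  have key : (s - r) * (t - s) * (t - r) * (A * x + B * y + C * z) =
      (t - s) * ((s * t * A - (s + t) * B + C) * (x + y * r + z * r ^ 2))
      + (t - r) * (-(r * t * A - (r + t) * B + C) * (x + y * s + z * s ^ 2))
      + (s - r) * ((r * s * A - (r + s) * B + C) * (x + y * t + z * t ^ 2)) := by ring
  have hD : 0 < (s - r) * (t - s) * (t - r) :=
    mul_pos (mul_pos (by linarith) (by linarith)) (by linarith)
  refine nonneg_of_mul_nonneg_right ?_ hD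
  rw [key]
  refine add_nonneg (add_nonneg ?_ ?_) ?_
  · exact mul_nonneg (by linarith) (mul_nonneg hr pr.le)
  · exact mul_nonneg (by linarith) (mul_nonneg (by linarith) ps.le)
  · exact mul_nonneg (by linarith) (mul_nonneg ht pt.le)

/-- The linear form on `x + y ρ + z ρ²` with value `a` on each of `1`, `ρ` and `δ² = (ρ (ρ - b))²`.
The value `a` clears the denominator of the form with value `1`. -/
def primaryFunctional (a b x y z : ℤ) : ℤ := a * x + a * y + (a * b - 1) * z

/-- The linear form on `x + y ρ + z ρ²` with value `a` on each of `1`, `(ρ - a) (ρ - b)` and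
`(ρ - a)²`. The factor `a` makes its values comparable with those of `primaryFunctional`. -/
def secondaryFunctional (a x y z : ℤ) : ℤ := a * (x + a * y + (a ^ 2 + 1) * z)

theorem functionals_nonneg {a b : ℤ} (ha : 2 ≤ a) (hab : a ≤ b - 2) {x y z : ℤ}
    (h : ∀ u : ℝ, u * (u - a) * (u - b) = 1 → 0 < x + y * u + z * u ^ 2) :
    0 ≤ primaryFunctional a b x y z ∧ 0 ≤ secondaryFunctional a x y z := by
  obtain ⟨r, s, t, ⟨hr0, hr1⟩, ⟨hs0, hs1⟩, ht, hroot⟩ := exists_real_roots ha hab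
  have ha' : (2 : ℝ) ≤ a := by exact_mod_cast ha
  have hab' : (a : ℝ) ≤ b - 2 := by exact_mod_cast hab
  have hr := hroot r (by simp)
  have hs := hroot s (by simp)
  have hte := hroot t (by simp)
  have hr2 : r < 1 := by nlinarith
  have hrs : r < s := by linarith
  have hst : s < t := by linarith
  have hpos := fun u hu => h u (hroot u hu)
  -- Vieta's formulas, by cancelling the differences of the three roots
  have d1 : r ^ 2 + r * s + s ^ 2 - (a + b) * (r + s) + a * b = 0 := by
    refine mul_left_cancel₀ (sub_ne_zero.2 hrs.ne) ?_
    linear_combination hr - hs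
  have d2 : s ^ 2 + s * t + t ^ 2 - (a + b) * (s + t) + a * b = 0 := by
    refine mul_left_cancel₀ (sub_ne_zero.2 hst.ne) ?_
    linear_combination hs - hte
  have e1 : r + s + t = a + b := by
    refine mul_left_cancel₀ (sub_ne_zero.2 (hrs.trans hst).ne) ?_
    linear_combination d1 - d2
  have e2 : r * s + r * t + s * t = a * b := by
    linear_combination -d1 + (r + s) * e1
  have e3 : r * s * t = 1 := by
    linear_combination hr + r * e2 - r ^ 2 * e1
  constructor
  · -- The conditions of `functional_nonneg` are checked after multiplication by the omitted root.
    have hmul : ∀ u v w : ℝ, u + v + w = a + b → u * v * w = 1 →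
        u * (v * w * a - (v + w) * a + (a * b - 1)) = (a * u - 1) * (u - a) := by
      intro u v w h1 h2
      linear_combination (a : ℝ) * h2 - u * a * h1
    have := functional_nonneg hrs hst (A := a) (B := a) (C := a * b - 1) (x := x) (y := y)
      (z := z) ?_ ?_ ?_ hpos
    · unfold primaryFunctional; exact_mod_cast this
    · refine nonneg_of_mul_nonneg_right (a := r) ?_ hr0
      rw [hmul r s t e1 e3]; nlinarith
    · refine nonpos_of_mul_nonpos_right (a := s) ?_ (by linarith)
      rw [hmul s r t (by linarith) (by linarith)]
      exact mul_nonpos_of_nonneg_of_nonpos (by nlinarith) (by linarith)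
    · refine nonneg_of_mul_nonneg_right (a := t) ?_ (by linarith)
      rw [hmul t r s (by linarith) (by linarith)]; nlinarith
  · have e4 : (a - r) * ((a - s) * (t - a)) = 1 := by
      linear_combination e3 - a * e2 + a ^ 2 * e1
    have := functional_nonneg hrs hst (A := 1) (B := a) (C := a ^ 2 + 1) (x := x) (y := y)
      (z := z) ?_ ?_ ?_ hpos
    · have : 0 ≤ x + a * y + (a ^ 2 + 1) * z := by
        rw [one_mul] at this; exact_mod_cast this
      exact mul_nonneg (by linarith) this
    · have : 0 < (a - s) * (t - a) := mul_pos (by linarith) (by linarith)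
      nlinarith
    · nlinarith
    · nlinarith [mul_pos (show 0 < a - r by linarith) (show 0 < a - s by linarith)]

/-! ### The field `K`: irreducibility, coordinates, embeddings and norms -/

theorem thomasPoly_natDegree (a b : ℤ) : (thomasPoly a b).natDegree = 3 := by
  unfold thomasPoly; compute_degree!

theorem thomasPoly_monic (a b : ℤ) : (thomasPoly a b).Monic := by
  unfold thomasPoly; monicity!

theorem aeval_thomasPoly {R : Type*} [CommRing R] (a b : ℤ) (x : R) :
    Polynomial.aeval x (thomasPoly a b) = x * (x - a) * (x - b) - 1 := by
  simp [thomasPoly]; ring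

theorem thomasPoly_irreducible {a b : ℤ} (ha : 2 ≤ a) (hab : a ≤ b - 2) :
    Irreducible (thomasPoly a b) := by
  rw [(thomasPoly_monic a b).irreducible_iff_roots_eq_zero_of_degree_le_three
    (by rw [thomasPoly_natDegree]; norm_num) (thomasPoly_natDegree a b).le,
    Multiset.eq_zero_iff_forall_notMem]
  intro n hn
  have h : n * (n - a) * (n - b) - 1 = 0 := by
    rw [Polynomial.mem_roots (thomasPoly_monic a b).ne_zero, Polynomial.IsRoot.def] at hn
    have := aeval_thomasPoly a b n
    rw [Polynomial.coe_aeval_eq_eval, hn] at this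
    exact this.symm
  have hu : IsUnit n := IsUnit.of_mul_eq_one ((n - a) * (n - b)) (by linarith)
  rcases Int.isUnit_iff.1 hu with rfl | rfl <;> nlinarith

section Field

variable {K : Type*} [Field K]

/-- The element of `ℤ[ρ]` with coordinates `x, y, z` with respect to `1, ρ, ρ²`. -/
def quadElement (ρ : K) (x y z : ℤ) : K := x + y * ρ + z * ρ ^ 2

theorem thomasElement_eq_quadElement (ρ : K) (a b v W : ℤ) :
    thomasElement ρ a b v W = quadElement ρ (-v) (b * (a * v + W) + 1) (-(a * v + W)) := by
  simp [thomasElement, quadElement]; ring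

theorem exists_quadElement_of_mem {a b : ℤ} {ρ : K} (hρ : ρ * (ρ - a) * (ρ - b) = 1) {α : K}
    (hα : α ∈ Algebra.adjoin ℤ {ρ}) : ∃ x y z, α = quadElement ρ x y z := by
  induction hα using Algebra.adjoin_induction with
  | mem α h => exact ⟨0, 1, 0, by simp_all [quadElement]⟩
  | algebraMap n => exact ⟨n, 0, 0, by simp [quadElement]⟩
  | add α β _ _ h₁ h₂ =>
    obtain ⟨x, y, z, rfl⟩ := h₁
    obtain ⟨x', y', z', rfl⟩ := h₂
    exact ⟨x + x', y + y', z + z', by simp only [quadElement]; push_cast; ring⟩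
  | mul α β _ _ h₁ h₂ =>
    obtain ⟨x, y, z, rfl⟩ := h₁
    obtain ⟨x', y', z', rfl⟩ := h₂
    refine ⟨x * x' + (y * z' + z * y') + z * z' * (a + b),
      x * y' + y * x' - a * b * (y * z' + z * y') + z * z' * (1 - (a + b) * (a * b)),
      x * z' + y * y' + z * x' + (a + b) * (y * z' + z * y') + z * z' * ((a + b) ^ 2 - a * b), ?_⟩
    simp only [quadElement]
    push_cast
    linear_combination ((y * z' + z * y') + z * z' * (ρ + (a + b)) : K) * hρ

variable [NumberField K] {a b : ℤ} {ρ : K}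

theorem exists_powerBasis (ha : 2 ≤ a) (hab : a ≤ b - 2)
    (hρ : Polynomial.aeval ρ (thomasPoly a b) = 0) (hK : IntermediateField.adjoin ℚ {ρ} = ⊤) :
    ∃ B : PowerBasis ℚ K, B.gen = ρ ∧ B.dim = 3 ∧
      minpoly ℚ ρ = (thomasPoly a b).map (algebraMap ℤ ℚ) := by
  have hint : IsIntegral ℚ ρ := Algebra.IsIntegral.isIntegral ρ
  have hmin : (thomasPoly a b).map (algebraMap ℤ ℚ) = minpoly ℚ ρ :=
    minpoly.eq_of_irreducible_of_monic
      ((thomasPoly_monic a b).irreducible_iff_irreducible_map_fraction_map.1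
        (thomasPoly_irreducible ha hab))
      (by rwa [Polynomial.aeval_map_algebraMap]) ((thomasPoly_monic a b).map _)
  have htop := (IntermediateField.adjoin_simple_eq_top_iff_of_isAlgebraic hint.isAlgebraic).1 hK
  refine ⟨PowerBasis.ofAdjoinEqTop hint htop, PowerBasis.ofAdjoinEqTop_gen hint htop, ?_, hmin.symm⟩
  rw [PowerBasis.ofAdjoinEqTop_dim, ← hmin, (thomasPoly_monic a b).natDegree_map,
    thomasPoly_natDegree]

theorem exists_embedding (ha : 2 ≤ a) (hab : a ≤ b - 2)
    (hρ : Polynomial.aeval ρ (thomasPoly a b) = 0) (hK : IntermediateField.adjoin ℚ {ρ} = ⊤)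
    {u : ℝ} (hu : u * (u - a) * (u - b) = 1) : ∃ σ : K →+* ℝ, σ ρ = u := by
  obtain ⟨B, rfl, -, hmin⟩ := exists_powerBasis ha hab hρ hK
  have h0 : Polynomial.aeval u (minpoly ℚ B.gen) = 0 := by
    rw [hmin, Polynomial.aeval_map_algebraMap, aeval_thomasPoly, hu, sub_self]
  exact ⟨(B.lift u h0).toRingHom, B.lift_gen u h0⟩

/-- The matrix is that of multiplication by `x + y ρ + z ρ²` on the basis `1, ρ, ρ²`. -/
theorem norm_quadElement (ha : 2 ≤ a) (hab : a ≤ b - 2)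
    (hρ : Polynomial.aeval ρ (thomasPoly a b) = 0) (hK : IntermediateField.adjoin ℚ {ρ} = ⊤)
    (x y z : ℤ) : Algebra.norm ℚ (quadElement ρ x y z) =
      (!![(x : ℚ), z, y + (a + b) * z;
        y, x - a * b * z, z - a * b * (y + (a + b) * z);
        z, y + (a + b) * z, x - a * b * z + (a + b) * (y + (a + b) * z)]).det := by
  obtain ⟨B, hgen, hdim, -⟩ := exists_powerBasis ha hab hρ hK
  rw [aeval_thomasPoly, sub_eq_zero] at hρ
  set c := B.basis.reindex (finCongr hdim) with hc
  have hcb : ∀ i, c i = ρ ^ (i : ℕ) := by intro i; simp [hc, hgen]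
  have hrepr : ∀ (w : K) (f : Fin 3 → ℚ), w = f 0 • 1 + f 1 • ρ + f 2 • ρ ^ 2 →
      ⇑(c.repr w) = f := by
    intro w f hw
    have h := c.repr_sum_self f
    rw [Fin.sum_univ_three, hcb, hcb, hcb] at h
    rw [hw]
    simpa only [Fin.val_zero, Fin.val_one, Fin.val_two, pow_zero, pow_one] using h
  rw [Algebra.norm_eq_matrix_det c]
  congr 1
  ext i j
  rw [Algebra.leftMulMatrix_eq_repr_mul, hcb]
  fin_cases j
  · rw [hrepr _ ![x, y, z]]
    · fin_cases i <;> rfl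
    · simp [quadElement, Rat.smul_def]
  · rw [hrepr _ ![z, x - a * b * z, y + (a + b) * z]]
    · fin_cases i <;> rfl
    · simp [quadElement, Rat.smul_def]
      linear_combination (z : K) * hρ
  · rw [hrepr _ ![y + (a + b) * z, z - a * b * (y + (a + b) * z),
      x - a * b * z + (a + b) * (y + (a + b) * z)]]
    · fin_cases i <;> rfl
    · simp [quadElement, Rat.smul_def]
      linear_combination (z * ρ + (y + (a + b) * z) : K) * hρ

theorem norm_thomasElement (ha : 2 ≤ a) (hab : a ≤ b - 2)
    (hρ : Polynomial.aeval ρ (thomasPoly a b) = 0) (hK : IntermediateField.adjoin ℚ {ρ} = ⊤)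
    (v W : ℤ) : Algebra.norm ℚ (thomasElement ρ a b v W) = thomasNorm a b v W := by
  rw [thomasElement_eq_quadElement, norm_quadElement ha hab hρ hK, Matrix.det_fin_three]
  simp [thomasNorm]
  ring

end Field

/-! ### Totally positive units and indecomposable elements -/

section Field

variable {K : Type*} [Field K] {O : Subalgebra ℤ K}

theorem IsTotallyPositive.mul {x y : K} (hx : IsTotallyPositive x) (hy : IsTotallyPositive y) :
    IsTotallyPositive (x * y) := fun σ => by
  rw [map_mul]; exact mul_pos (hx σ) (hy σ)

/-- An indecomposable element that dominates a totally positive element of `O` at every real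
embedding is equal to it, since otherwise the difference would be totally positive. -/
theorem IsIndecomposableIn.eq_of_le {α β : K} (hα : IsIndecomposableIn O α) (hβ : β ∈ O)
    (hβ' : IsTotallyPositive β) (hle : ∀ σ : K →+* ℝ, σ β ≤ σ α) : α = β := by
  by_contra hne
  refine hα.2.2 ⟨β, hβ, α - β, sub_mem hα.1 hβ, hβ', fun σ => ?_, by ring⟩
  rw [map_sub, sub_pos]
  exact lt_of_le_of_ne (hle σ) fun h => hne (σ.injective h).symm

/-- `u` is a totally positive unit of the order `O`. Total positivity of the inverse, which is
automatic, is part of the definition for convenience. -/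
def IsTotallyPositiveUnit (O : Subalgebra ℤ K) (u : K) : Prop :=
  u ∈ O ∧ IsTotallyPositive u ∧ ∃ u' ∈ O, IsTotallyPositive u' ∧ u * u' = 1

theorem IsTotallyPositiveUnit.symm {u u' : K} (hu : IsTotallyPositiveUnit O u) (hu' : u' ∈ O)
    (h : u * u' = 1) : IsTotallyPositiveUnit O u' := by
  obtain ⟨h1, h2, w, hw, hw', h3⟩ := hu
  have : w = u' := by
    rw [← mul_one w, ← h, ← mul_assoc, mul_comm w, h3, one_mul]
  subst this
  exact ⟨hw, hw', u, h1, h2, by rw [mul_comm, h]⟩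

theorem IsTotallyPositiveUnit.mul {u w : K} (hu : IsTotallyPositiveUnit O u)
    (hw : IsTotallyPositiveUnit O w) : IsTotallyPositiveUnit O (u * w) := by
  obtain ⟨h1, h2, u', h3, h4, h5⟩ := hu
  obtain ⟨g1, g2, w', g3, g4, g5⟩ := hw
  exact ⟨mul_mem h1 g1, h2.mul g2, u' * w', mul_mem h3 g3, h4.mul g4, by
    rw [mul_mul_mul_comm, h5, g5, one_mul]⟩

theorem IsIndecomposableIn.unit_mul {α u : K} (hα : IsIndecomposableIn O α)
    (hu : IsTotallyPositiveUnit O u) : IsIndecomposableIn O (u * α) := by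
  obtain ⟨h1, h2, u', h3, h4, h5⟩ := hu
  refine ⟨mul_mem h1 hα.1, h2.mul hα.2.1, ?_⟩
  rintro ⟨β, hβ, γ, hγ, pβ, pγ, h⟩
  refine hα.2.2 ⟨u' * β, mul_mem h3 hβ, u' * γ, mul_mem h3 hγ, h4.mul pβ, h4.mul pγ, ?_⟩
  rw [← mul_add, ← h, ← mul_assoc, mul_comm u', h5, one_mul]

end Field

section Reduction

variable {K : Type*} [Field K] {a b : ℤ} {ρ : K}

theorem isTotallyPositive_root (hρ : ρ * (ρ - a) * (ρ - b) = 1) (ha : 2 ≤ a) (hab : a ≤ b - 2) :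
    IsTotallyPositive ρ := fun σ => by
  have ha' : (2 : ℝ) ≤ a := by exact_mod_cast ha
  have hab' : (a : ℝ) ≤ b - 2 := by exact_mod_cast hab
  have h : σ ρ * (σ ρ - a) * (σ ρ - b) = 1 := by simpa using congrArg σ hρ
  by_contra hneg
  have h1 : 0 ≤ (σ ρ - a) * (σ ρ - b) :=
    mul_nonneg_of_nonpos_of_nonpos (by linarith) (by linarith)
  have h2 := mul_nonpos_of_nonpos_of_nonneg (not_lt.1 hneg) h1
  linarith

/-- The generators of the two cones other than `1`; the last two are inverse to each other, and so
are the first two. -/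
theorem isTotallyPositiveUnit_vertices (hρ : ρ * (ρ - a) * (ρ - b) = 1) (ha : 2 ≤ a)
    (hab : a ≤ b - 2) :
    IsTotallyPositiveUnit (Algebra.adjoin ℤ {ρ}) ρ ∧
    IsTotallyPositiveUnit (Algebra.adjoin ℤ {ρ}) ((ρ - a) * (ρ - b)) ∧
    IsTotallyPositiveUnit (Algebra.adjoin ℤ {ρ}) ((ρ - a) ^ 2) ∧
    IsTotallyPositiveUnit (Algebra.adjoin ℤ {ρ}) ((ρ * (ρ - b)) ^ 2) := by
  have hmem : ρ ∈ Algebra.adjoin ℤ {ρ} := Algebra.self_mem_adjoin_singleton ℤ ρ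
  have hma : ρ - a ∈ Algebra.adjoin ℤ {ρ} := sub_mem hmem (intCast_mem _ a)
  have hmb : ρ - b ∈ Algebra.adjoin ℤ {ρ} := sub_mem hmem (intCast_mem _ b)
  have hpos := isTotallyPositive_root hρ ha hab
  have hu : IsTotallyPositiveUnit (Algebra.adjoin ℤ {ρ}) ρ := by
    refine ⟨hmem, hpos, (ρ - a) * (ρ - b), mul_mem hma hmb, fun σ => ?_, by rw [← mul_assoc, hρ]⟩
    refine (pos_iff_pos_of_mul_pos ?_).1 (hpos σ)
    rw [← map_mul, ← mul_assoc, hρ, map_one]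
    exact one_pos
  have hsq : ∀ w : K, w ≠ 0 → IsTotallyPositive (w ^ 2) := fun w hw σ => by
    rw [map_pow]
    exact sq_pos_of_ne_zero ((map_ne_zero σ).2 hw)
  have hq : IsTotallyPositiveUnit (Algebra.adjoin ℤ {ρ}) ((ρ - a) ^ 2) := by
    refine ⟨pow_mem hma 2, hsq _ fun h => ?_, (ρ * (ρ - b)) ^ 2, pow_mem (mul_mem hmem hmb) 2,
      hsq _ fun h => ?_, ?_⟩
    · rw [h] at hρ; simp at hρ
    · rw [mul_right_comm, h] at hρ; simp at hρ
    · linear_combination (ρ * (ρ - a) * (ρ - b) + 1) * hρ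
  refine ⟨hu, hu.symm (mul_mem hma hmb) (by rw [← mul_assoc, hρ]), hq,
    hq.symm (pow_mem (mul_mem hmem hmb) 2) ?_⟩
  linear_combination (ρ * (ρ - a) * (ρ - b) + 1) * hρ

end Reduction

/-! ### Reduction to the two cones -/

/-- The smallest value of two nonnegative integer functions is a value of one of them, and is at
most every value of the other. -/
theorem exists_min_of_two {ι : Type*} {S : Set ι} (hS : S.Nonempty) {f g : ι → ℤ}
    (hf : ∀ s ∈ S, 0 ≤ f s) (hg : ∀ s ∈ S, 0 ≤ g s) :
    (∃ s ∈ S, ∀ s' ∈ S, f s ≤ g s') ∨ ∃ s ∈ S, ∀ s' ∈ S, g s ≤ f s' := by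
  have hmin : ∀ h : ι → ℤ, (∀ s ∈ S, 0 ≤ h s) → ∃ s ∈ S, ∀ s' ∈ S, h s ≤ h s' := by
    intro h hh
    obtain ⟨s, hs, hs'⟩ := (measure fun s => (h s).toNat).wf.has_min S hS
    refine ⟨s, hs, fun s' hs₁ => ?_⟩
    have h1 : ¬ (h s').toNat < (h s).toNat := hs' s' hs₁
    have h2 := hh s hs
    have h3 := hh s' hs₁
    omega
  obtain ⟨s, hs, hs'⟩ := hmin f hf
  obtain ⟨t, ht, ht'⟩ := hmin g hg
  rcases le_total (f s) (g t) with h | h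
  · exact Or.inl ⟨s, hs, fun s' hs₁ => h.trans (ht' s' hs₁)⟩
  · exact Or.inr ⟨t, ht, fun s' hs₁ => h.trans (hs' s' hs₁)⟩

section Reduction

variable {K : Type*} [Field K] {a b : ℤ} {ρ : K}

theorem root_mul_quadElement (hρ : ρ * (ρ - a) * (ρ - b) = 1) (x y z : ℤ) :
    ρ * quadElement ρ x y z = quadElement ρ z (x - a * b * z) (y + (a + b) * z) := by
  simp only [quadElement]
  push_cast
  linear_combination (z : K) * hρ

theorem root_sub_mul_quadElement (hρ : ρ * (ρ - a) * (ρ - b) = 1) (x y z : ℤ) :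
    (ρ - a) * quadElement ρ x y z =
      quadElement ρ (z - a * x) (x - a * b * z - a * y) (y + b * z) := by
  simp only [quadElement]
  push_cast
  linear_combination (z : K) * hρ

theorem root_sub_mul_quadElement' (hρ : ρ * (ρ - a) * (ρ - b) = 1) (x y z : ℤ) :
    (ρ - b) * quadElement ρ x y z =
      quadElement ρ (z - b * x) (x - a * b * z - b * y) (y + a * z) := by
  simp only [quadElement]
  push_cast
  linear_combination (z : K) * hρ

variable [NumberField K]

theorem norm_units (ha : 2 ≤ a) (hab : a ≤ b - 2)
    (hρ : Polynomial.aeval ρ (thomasPoly a b) = 0) (hK : IntermediateField.adjoin ℚ {ρ} = ⊤) :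
    Algebra.norm ℚ ρ = 1 ∧ Algebra.norm ℚ (ρ - a) = 1 ∧ Algebra.norm ℚ (ρ - b) = 1 := by
  have h1 : Algebra.norm ℚ ρ = 1 := by
    have := norm_quadElement ha hab hρ hK 0 1 0
    rw [Matrix.det_fin_three] at this
    simpa [quadElement] using this
  have h2 : Algebra.norm ℚ (ρ - a) = 1 := by
    have := norm_quadElement ha hab hρ hK (-a) 1 0
    rw [Matrix.det_fin_three] at this
    have e : quadElement ρ (-a) 1 0 = ρ - a := by simp [quadElement]; ring
    rw [e] at this
    rw [this]
    simp
    ring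
  refine ⟨h1, h2, ?_⟩
  rw [aeval_thomasPoly, sub_eq_zero] at hρ
  have := congrArg (Algebra.norm ℚ) hρ
  rw [map_mul, map_mul, h1, h2, map_one] at this
  linarith

/-- The norm of `β` is at most `1`, or that of a lattice point of one of the two half-open
parallelepipeds: `α(v, W)` in the primary one, `(ρ - a) (ρ - (b - k))` in the secondary one. -/
def HasSmallNorm (a b : ℤ) (β : K) : Prop :=
  Algebra.norm ℚ β ≤ 1 ∨
    (∃ v W, 0 ≤ v ∧ v < b - a ∧ 0 ≤ W ∧ W < a ∧ Algebra.norm ℚ β = thomasNorm a b v W) ∨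
    ∃ k, 0 < k ∧ k < b - a ∧ Algebra.norm ℚ β = (1 + k * (b - k) * (b - a - k) : ℤ)

/-- The hypotheses say that the coordinates of `β` with respect to `1, ρ, δ²` are nonnegative: these
coordinates are `(a x - z) / a`, `(a d y + (a b d + 1) z) / (a d)` and `-z / (a d)`, where
`d = b - a`. -/
theorem hasSmallNorm_of_mem_primaryCone (ha : 2 ≤ a) (hab : a ≤ b - 2)
    (hρ : Polynomial.aeval ρ (thomasPoly a b) = 0) (hK : IntermediateField.adjoin ℚ {ρ} = ⊤)
    {x y z : ℤ} (hβ : IsIndecomposableIn (Algebra.adjoin ℤ {ρ}) (quadElement ρ x y z))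
    (h₁ : 0 ≤ a * x - z) (h₂ : 0 ≤ a * (b - a) * y + (a * b * (b - a) + 1) * z) (h₃ : z ≤ 0) :
    HasSmallNorm a b (quadElement ρ x y z) := by
  obtain ⟨n₁, n₂, n₃⟩ := norm_units ha hab hρ hK
  have hρ' := hρ
  rw [aeval_thomasPoly, sub_eq_zero] at hρ'
  obtain ⟨u₁, -, -, u₂⟩ := isTotallyPositiveUnit_vertices hρ' ha hab
  have hd : (0 : ℝ) < a * (b - a) := by
    exact_mod_cast mul_pos (show 0 < a by linarith) (show 0 < b - a by linarith)
  have hd' : (0 : ℝ) ≤ b - a := by exact_mod_cast (show 0 ≤ b - a by linarith)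
  have hσ : ∀ σ : K →+* ℝ, a * (b - a) * σ (quadElement ρ x y z) =
      (b - a) * (a * x - z) + (a * (b - a) * y + (a * b * (b - a) + 1) * z) * σ ρ
        + (-z) * σ ((ρ * (ρ - b)) ^ 2) := by
    intro σ
    have h : σ ρ * (σ ρ - a) * (σ ρ - b) = 1 := by simpa using congrArg σ hρ'
    simp only [quadElement, map_add, map_mul, map_pow, map_sub, map_intCast]
    linear_combination (z * (σ ρ + a - b)) * h
  have r₁ : (0 : ℝ) ≤ a * x - z := by exact_mod_cast h₁
  have r₂ : (0 : ℝ) ≤ a * (b - a) * y + (a * b * (b - a) + 1) * z := by exact_mod_cast h₂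
  have r₃ : (0 : ℝ) ≤ -z := by exact_mod_cast neg_nonneg.2 h₃
  by_cases c₁ : a ≤ a * x - z
  · refine Or.inl (le_of_eq ?_)
    rw [hβ.eq_of_le (one_mem _) (fun σ => by simp) fun σ => ?_, map_one]
    refine le_of_mul_le_mul_left ?_ hd
    rw [hσ, map_one]
    have c₁' : (a : ℝ) ≤ a * x - z := by exact_mod_cast c₁
    have := mul_nonneg r₂ (u₁.2.1 σ).le
    have := mul_nonneg r₃ (u₂.2.1 σ).le
    have := mul_le_mul_of_nonneg_left c₁' hd'
    linarith
  by_cases c₂ : a * (b - a) ≤ a * (b - a) * y + (a * b * (b - a) + 1) * z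
  · refine Or.inl (le_of_eq ?_)
    rw [hβ.eq_of_le u₁.1 u₁.2.1 fun σ => ?_, n₁]
    refine le_of_mul_le_mul_left ?_ hd
    rw [hσ]
    have c₂' : (a : ℝ) * (b - a) ≤ a * (b - a) * y + (a * b * (b - a) + 1) * z := by
      exact_mod_cast c₂
    have := mul_nonneg hd' r₁
    have := mul_nonneg r₃ (u₂.2.1 σ).le
    have := mul_le_mul_of_nonneg_right c₂' (u₁.2.1 σ).le
    linarith
  by_cases c₃ : a * (b - a) ≤ -z
  · refine Or.inl (le_of_eq ?_)
    rw [hβ.eq_of_le u₂.1 u₂.2.1 fun σ => ?_, map_pow, map_mul, n₁, n₃]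
    · norm_num
    refine le_of_mul_le_mul_left ?_ hd
    rw [hσ]
    have c₃' : (a : ℝ) * (b - a) ≤ -z := by exact_mod_cast c₃
    have := mul_nonneg hd' r₁
    have := mul_nonneg r₂ (u₁.2.1 σ).le
    have := mul_le_mul_of_nonneg_right c₃' (u₂.2.1 σ).le
    linarith
  push Not at c₁ c₂ c₃
  have hd0 : 0 < a * (b - a) := by exact_mod_cast hd
  rcases eq_or_lt_of_le h₃ with rfl | hz
  · -- The only lattice point with vanishing last coordinate is `0`, of norm `0`.
    have hx : x = 0 := by
      have : 0 ≤ x := by by_contra hx; nlinarith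
      have : x < 1 := by by_contra hx; nlinarith
      omega
    have hy : y = 0 := by
      have : 0 ≤ y := by by_contra hy; nlinarith
      have : y < 1 := by by_contra hy; nlinarith
      omega
    left
    simp [hx, hy, quadElement]
  · -- `y + b * z` times `a * (b - a)` lies strictly between `0` and `2 * (a * (b - a))`
    have hy : y = b * (-z) + 1 := by
      have e : a * (b - a) * (y + b * z) = a * (b - a) * y + (a * b * (b - a) + 1) * z - z := by
        ring
      have : 0 < y + b * z := by by_contra hy; nlinarith
      have : y + b * z < 2 := by by_contra hy; nlinarith
      linarith
    refine Or.inr (Or.inl ⟨-x, a * x - z, ?_, ?_, h₁, c₁, ?_⟩)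
    · by_contra hx; nlinarith
    · by_contra hx; nlinarith
    · rw [← norm_thomasElement ha hab hρ hK, thomasElement_eq_quadElement, hy]
      congr 2 <;> ring

/-- The hypotheses say that the coordinates of `β` with respect to `1, (ρ - a) (ρ - b), (ρ - a)²`
are nonnegative: these coordinates are `x + a y + a² z`, `-(y + 2 a z) / d` and
`(y + (a + b) z) / d`, where `d = b - a`. -/
theorem hasSmallNorm_of_mem_secondaryCone (ha : 2 ≤ a) (hab : a ≤ b - 2)
    (hρ : Polynomial.aeval ρ (thomasPoly a b) = 0) (hK : IntermediateField.adjoin ℚ {ρ} = ⊤)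
    {x y z : ℤ} (hβ : IsIndecomposableIn (Algebra.adjoin ℤ {ρ}) (quadElement ρ x y z))
    (h₁ : 0 ≤ x + a * y + a ^ 2 * z) (h₂ : 0 ≤ -(y + 2 * a * z)) (h₃ : 0 ≤ y + (a + b) * z) :
    HasSmallNorm a b (quadElement ρ x y z) := by
  obtain ⟨n₁, n₂, n₃⟩ := norm_units ha hab hρ hK
  have hρ' := hρ
  rw [aeval_thomasPoly, sub_eq_zero] at hρ'
  obtain ⟨-, u₁, u₂, -⟩ := isTotallyPositiveUnit_vertices hρ' ha hab
  have hd : (0 : ℝ) < b - a := by exact_mod_cast (show 0 < b - a by linarith)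
  have hσ : ∀ σ : K →+* ℝ, (b - a) * σ (quadElement ρ x y z) =
      (b - a) * (x + a * y + a ^ 2 * z) + (-(y + 2 * a * z)) * σ ((ρ - a) * (ρ - b))
        + (y + (a + b) * z) * σ ((ρ - a) ^ 2) := by
    intro σ
    simp only [quadElement, map_add, map_mul, map_pow, map_sub, map_intCast]
    ring
  have r₁ : (0 : ℝ) ≤ x + a * y + a ^ 2 * z := by exact_mod_cast h₁
  have r₂ : (0 : ℝ) ≤ -(y + 2 * a * z) := by exact_mod_cast h₂
  have r₃ : (0 : ℝ) ≤ y + (a + b) * z := by exact_mod_cast h₃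
  by_cases c₁ : 1 ≤ x + a * y + a ^ 2 * z
  · refine Or.inl (le_of_eq ?_)
    rw [hβ.eq_of_le (one_mem _) (fun σ => by simp) fun σ => ?_, map_one]
    refine le_of_mul_le_mul_left ?_ hd
    rw [hσ, map_one]
    have c₁' : (1 : ℝ) ≤ x + a * y + a ^ 2 * z := by exact_mod_cast c₁
    have := mul_nonneg r₂ (u₁.2.1 σ).le
    have := mul_nonneg r₃ (u₂.2.1 σ).le
    have := mul_le_mul_of_nonneg_left c₁' hd.le
    linarith
  by_cases c₂ : b - a ≤ -(y + 2 * a * z)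
  · refine Or.inl (le_of_eq ?_)
    rw [hβ.eq_of_le u₁.1 u₁.2.1 fun σ => ?_, map_mul, n₂, n₃]
    · norm_num
    refine le_of_mul_le_mul_left ?_ hd
    rw [hσ]
    have c₂' : (b : ℝ) - a ≤ -(y + 2 * a * z) := by exact_mod_cast c₂
    have := mul_nonneg hd.le r₁
    have := mul_nonneg r₃ (u₂.2.1 σ).le
    have := mul_le_mul_of_nonneg_right c₂' (u₁.2.1 σ).le
    linarith
  by_cases c₃ : b - a ≤ y + (a + b) * z
  · refine Or.inl (le_of_eq ?_)
    rw [hβ.eq_of_le u₂.1 u₂.2.1 fun σ => ?_, map_pow, n₂]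
    · norm_num
    refine le_of_mul_le_mul_left ?_ hd
    rw [hσ]
    have c₃' : (b : ℝ) - a ≤ y + (a + b) * z := by exact_mod_cast c₃
    have := mul_nonneg hd.le r₁
    have := mul_nonneg r₂ (u₁.2.1 σ).le
    have := mul_le_mul_of_nonneg_right c₃' (u₂.2.1 σ).le
    linarith
  push Not at c₁ c₂ c₃
  have hx : x = -(a * y + a ^ 2 * z) := by linarith
  -- The last two coordinates, each less than `1`, have sum `z`.
  have hz0 : 0 ≤ z := by by_contra hz; nlinarith
  have hz2 : z < 2 := by by_contra hz; nlinarith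
  obtain rfl | rfl : z = 0 ∨ z = 1 := by omega
  · obtain rfl : y = 0 := by linarith
    left
    simp [hx, quadElement]
  · refine Or.inr (Or.inr ⟨y + (a + b), by linarith, by linarith, ?_⟩)
    rw [norm_quadElement ha hab hρ hK, Matrix.det_fin_three, hx]
    simp
    ring

/-- The minimum of the two linear forms over all indecomposable elements with the norm of `α` is
attained at an element of one of the two cones. -/
theorem hasSmallNorm_of_isIndecomposableIn (ha : 2 ≤ a) (hab : a ≤ b - 2)
    (hρ : Polynomial.aeval ρ (thomasPoly a b) = 0) (hK : IntermediateField.adjoin ℚ {ρ} = ⊤)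
    {α : K} (hα : IsIndecomposableIn (Algebra.adjoin ℤ {ρ}) α) : HasSmallNorm a b α := by
  obtain ⟨n₁, n₂, n₃⟩ := norm_units ha hab hρ hK
  have hρ' := hρ
  rw [aeval_thomasPoly, sub_eq_zero] at hρ'
  obtain ⟨u₁, u₂, u₃, u₄⟩ := isTotallyPositiveUnit_vertices hρ' ha hab
  -- coordinate vectors of the indecomposable elements with the norm of `α`
  let S : Set (ℤ × ℤ × ℤ) := {t | IsIndecomposableIn (Algebra.adjoin ℤ {ρ})
    (quadElement ρ t.1 t.2.1 t.2.2) ∧ Algebra.norm ℚ (quadElement ρ t.1 t.2.1 t.2.2) =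
      Algebra.norm ℚ α}
  have hS : S.Nonempty := by
    obtain ⟨x, y, z, rfl⟩ := exists_quadElement_of_mem hρ' hα.1
    exact ⟨(x, y, z), hα, rfl⟩
  have hunit : ∀ {u : K} {x y z x' y' z' : ℤ}, IsTotallyPositiveUnit (Algebra.adjoin ℤ {ρ}) u →
      Algebra.norm ℚ u = 1 → (x, y, z) ∈ S → u * quadElement ρ x y z = quadElement ρ x' y' z' →
      (x', y', z') ∈ S := by
    rintro u x y z x' y' z' hu hu1 ⟨hs₁, hs₂⟩ h
    refine ⟨?_, ?_⟩
    · simp only [← h]; exact hs₁.unit_mul hu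
    · simp only [← h, map_mul, hu1, one_mul]; exact hs₂
  have hfun : ∀ s ∈ S, 0 ≤ primaryFunctional a b s.1 s.2.1 s.2.2 ∧
      0 ≤ secondaryFunctional a s.1 s.2.1 s.2.2 := by
    rintro ⟨x, y, z⟩ ⟨hs, -⟩
    refine functionals_nonneg ha hab fun u hu => ?_
    obtain ⟨σ, hσ⟩ := exists_embedding ha hab hρ hK hu
    simpa [quadElement, hσ] using hs.2.1 σ
  have hd : 2 ≤ b - a := by linarith
  have had : 0 < a * (b - a) - 1 := by nlinarith
  have haa : 0 < a ^ 2 - a - 1 := by nlinarith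
  have mρ := root_mul_quadElement hρ'
  have ma := root_sub_mul_quadElement hρ'
  have mb := root_sub_mul_quadElement' hρ'
  rcases exists_min_of_two hS (fun s hs => (hfun s hs).1) (fun s hs => (hfun s hs).2) with
    ⟨⟨x, y, z⟩, hs, hmin⟩ | ⟨⟨x, y, z⟩, hs, hmin⟩
  · -- The three differences of forms are the coordinates with respect to `1, ρ, δ²` multiplied by
    -- positive integers.
    have h₃ := hmin _ (hunit u₂ (by rw [map_mul, n₂, n₃]; norm_num) hs
      (by rw [mul_assoc, mb, ma]))
    have h₂ := hmin _ (hunit u₃ (by rw [map_pow, n₂]; norm_num) hs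
      (by rw [sq, mul_assoc, ma, ma]))
    have h₁ := hmin _ (hunit (u₂.mul u₃) (by rw [map_mul, map_mul, map_pow, n₂, n₃]; norm_num) hs
      (by rw [sq, mul_assoc, mul_assoc, mul_assoc, ma, ma, mb, ma]))
    simp only [primaryFunctional, secondaryFunctional] at h₁ h₂ h₃
    unfold HasSmallNorm
    rw [← hs.2]
    refine hasSmallNorm_of_mem_primaryCone ha hab hρ hK hs.1 ?_ ?_ ?_
    · refine nonneg_of_mul_nonneg_right (a := a ^ 2 - a - 1) ?_ haa
      linarith
    · linarith
    · refine nonpos_of_mul_nonpos_right (a := a * (b - a) - 1) ?_ had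
      linarith
  · -- Likewise for the coordinates with respect to `1, (ρ - a) (ρ - b), (ρ - a)²`.
    have h₃ := hmin _ (hunit u₁ n₁ hs (mρ _ _ _))
    have h₂ := hmin _ (hunit u₄ (by rw [map_pow, map_mul, n₁, n₃]; norm_num) hs
      (by rw [sq, mul_assoc, mul_assoc, mul_assoc, mb, mρ, mb, mρ]))
    have h₁ := hmin _ (hunit (u₁.mul u₄) (by rw [map_mul, map_pow, map_mul, n₁, n₃]; norm_num) hs
      (by rw [sq, mul_assoc, mul_assoc, mul_assoc, mul_assoc, mb, mρ, mb, mρ, mρ]))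
    simp only [primaryFunctional, secondaryFunctional] at h₁ h₂ h₃
    unfold HasSmallNorm
    rw [← hs.2]
    refine hasSmallNorm_of_mem_secondaryCone ha hab hρ hK hs.1 ?_ ?_ ?_
    · refine nonneg_of_mul_nonneg_right (a := a ^ 2 - a - 1) ?_ haa
      linarith
    · linarith
    · refine nonneg_of_mul_nonneg_right (a := a * (b - a) - 1) ?_ had
      linarith

/-! ### The norm bound -/

theorem exists_norm_le (ha : 2 ≤ a) (hab : a ≤ b - 2) {α : K} (hα : HasSmallNorm a b α) :
    ∃ v, 0 ≤ v ∧ v < b - a ∧ Algebra.norm ℚ α ≤ thomasNorm a b v (a - 1) := by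
  rcases hα with h | ⟨v, W, hv, hv', hW, hW', h⟩ | ⟨k, hk, hk', h⟩
  · exact ⟨0, le_rfl, by linarith, h.trans (by exact_mod_cast one_le_thomasNorm ha hab)⟩
  · obtain ⟨v', h₀, h₁, h₂⟩ := exists_thomasNorm_ge ha hab hv hv' hW hW'
    exact ⟨v', h₀, h₁, h.le.trans (by exact_mod_cast h₂)⟩
  · exact ⟨b - a - k, by linarith, by linarith,
      h.le.trans (by exact_mod_cast edgeNorm_le_thomasNorm ha hk hk')⟩

end Reduction

theorem mainTheorem9 {K : Type*} [Field K] [NumberField K] (a b : ℤ) (ha : 2 ≤ a)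
    (hab : a ≤ b - 2) (ρ : K) (hρ : Polynomial.aeval ρ (thomasPoly a b) = 0)
    (hK : IntermediateField.adjoin ℚ {ρ} = ⊤)
    (L l₀ : ℤ) (hl₀ : l₀ = 0 ∨ l₀ = 1) (hL : b - a = 2 * L + l₀)
    (α : K) (hα : IsIndecomposableIn (Algebra.adjoin ℤ {ρ}) α) :
    (a = 2 ∧ b = 4 → Algebra.norm ℚ α ≤ 16) ∧
    (¬ (a = 2 ∧ b = 4) → l₀ = 0 →
      (Algebra.norm ℚ α : WithBot ℚ) ≤ maxNormInWindow ρ a b (L - 1) (2 * L - 1)) ∧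
    (¬ (a = 2 ∧ b = 4) → l₀ = 1 →
      (Algebra.norm ℚ α : WithBot ℚ) ≤ maxNormInWindow ρ a b L (2 * L)) := by
  obtain ⟨v, hv, hv', hle⟩ :=
    exists_norm_le ha hab (hasSmallNorm_of_isIndecomposableIn ha hab hρ hK hα)
  have hwindow : ∀ lo hi : ℤ, b - a - 2 ≤ 2 * lo → 2 * lo ≤ b - a - 1 → hi = b - a - 1 →
      (Algebra.norm ℚ α : WithBot ℚ) ≤ maxNormInWindow ρ a b lo hi := by
    intro lo hi h₁ h₂ h₃
    obtain ⟨v', hmem, hle'⟩ := exists_mem_window_thomasNorm_ge ha hab hv hv' h₁ h₂ h₃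
    refine (WithBot.coe_le_coe.2 ?_).trans
      (Finset.le_max (Finset.mem_image_of_mem _ hmem))
    rw [norm_thomasElement ha hab hρ hK]
    exact hle.trans (by exact_mod_cast hle')
  refine ⟨?_, fun _ h => hwindow _ _ (by omega) (by omega) (by omega),
    fun _ h => hwindow _ _ (by omega) (by omega) (by omega)⟩
  rintro ⟨rfl, rfl⟩
  -- the two candidates `v = 0` and `v = 1` have norms `14` and `16`
  have h16 : thomasNorm 2 4 v (2 - 1) ≤ 16 := by
    obtain rfl | rfl : v = 0 ∨ v = 1 := by omega
    all_goals decide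
  exact hle.trans (by exact_mod_cast h16)
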